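/- Let $X$ be a real Banach space with dual $X^*$, and let $f \colon X \to \mathbb{R} \cup \{+\infty\}$ be a closed (i.e. lower semicontinuous) convex function with effective domain $\operatorname{dom} f = \{x \in X : f(x) \in \mathbb{R}\}$. Equip $\mathbb{R} \times X^*$ with the product of the usual topology of $\mathbb{R}$ and the weak* topology of $X^*$, called the weak* topology. A weak* compact set $H \subset \mathbb{R} \times X^*$ is called a hypodifferential of $f$ at $x \in \operatorname{dom} f$ if $\max_{(a, x^*) \in H} a = 0$ and $$\lim_{\alpha \to +0} \frac{1}{\alpha} \Big| f(x + \alpha \Delta x) - f(x) - \max_{(a, x^*) \in H} \big( a + \alpha \langle x^*, \Delta x \rangle \big) \Big| = 0 \qquad \text{for all } \Delta x \in X;$$ $f$ is called hypodifferentiable at $x \in \operatorname{dom} f$ if it has a hypodifferential at $x$. Let $\partial f(x) = \{x^* \in X^* : f(y) \ge f(x) + \langle x^*, y - x \rangle \ \forall y \in X\}$ for $x \in \operatorname{dom} f$, let $f'(x, u) = \lim_{\alpha \to +0} (f(x + \alpha u) - f(x))/\alpha$, and for $Q \subset X$ let $\operatorname{core} Q$ be the set of all $x \in Q$ such that for every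 $y \in X$ there is $t_y > 0$ with $x + t y \in Q$ for all $t \in [0, t_y]$. Then: 1. $f$ is hypodifferentiable at every point $x \in \operatorname{int} \operatorname{dom} f$. 2. If $f$ is hypodifferentiable at a point $x \in \operatorname{dom} f$, then $x \in \operatorname{core} \operatorname{dom} f$, the subdifferential $\partial f(x)$ is nonempty and weak* compact, the directional derivative $f'(x, u)$ exists in $[-\infty, +\infty]$ for every $u \in X$, and $f'(x, \cdot)$ is a proper closed convex function. 3. If $f$ is hypodifferentiable at a point $x \in \operatorname{dom} f$, then a convex weak* compact set $H \subset \mathbb{R} \times X^*$ is a hypodifferential of $f$ at $x$ if and only if (a) $a \le 0$ for every $(a, x^*) \in H$; (b) there exists $x^* \in X^*$ such that $(0, x^*) \in H$; (c) $\{x^* \in X^* : (0, x^*) \in H\} = \partial f(x)$. Moreover, any weak* compact set $H$, convex or not, that satisfies (a)-(c) is a hypodifferential of $f$ at $x$. -/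

import Mathlib

open Filter Topology

namespace ConvexHypo

variable {X : Type*} [NormedAddCommGroup X] [NormedSpace ℝ X]

/-- The effective domain `{x | f x ∈ ℝ}` of an extended-real-valued function. -/
def effDom (f : X → EReal) : Set X := {x | f x ≠ ⊤ ∧ f x ≠ ⊥}

/-- The epigraph `{(x, r) ∈ X × ℝ | f x ≤ r}`. -/
def epigraph (f : X → EReal) : Set (X × ℝ) := {p | f p.1 ≤ (p.2 : EReal)}

/-- A closed convex function `f : X → ℝ ∪ {+∞}`: it never takes the value `-∞`, its epigraph is
convex, and it is lower semicontinuous (equivalently, its epigraph is closed). -/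
structure IsClosedConvex (f : X → EReal) : Prop where
  ne_bot : ∀ x, f x ≠ ⊥
  convex : Convex ℝ (epigraph f)
  lsc : LowerSemicontinuous f

/-- A proper closed convex function: moreover, it is not identically `+∞`. -/
structure IsProperClosedConvex (f : X → EReal) : Prop extends IsClosedConvex f where
  exists_ne_top : ∃ x, f x ≠ ⊤

/-- The algebraic interior (radial kernel) of a set. -/
def algCore (Q : Set X) : Set X :=
  {x | x ∈ Q ∧ ∀ y : X, ∃ τ : ℝ, 0 < τ ∧ ∀ t ∈ Set.Icc (0 : ℝ) τ, x + t • y ∈ Q}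

/-- The subdifferential of `f` at `x` in the sense of convex analysis (empty off the effective
domain), as a subset of the dual space carrying the weak* topology. -/
def subdifferential (f : X → EReal) (x : X) : Set (WeakDual ℝ X) :=
  {v | x ∈ effDom f ∧ ∀ y : X, f x + ((v (y - x) : ℝ) : EReal) ≤ f y}

/-- `d` is the directional derivative of `f` at `x` in the direction `u`:
`(f (x + α u) - f x) / α → d` in `[-∞, +∞]` as `α → +0`. -/
def HasDirDeriv (f : X → EReal) (x u : X) (d : EReal) : Prop :=
  Tendsto (fun α : ℝ => (f (x + α • u) - f x) / (α : EReal)) (𝓝[>] (0 : ℝ)) (𝓝 d)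

/-- `max {a + ⟨v, u⟩ | (a, v) ∈ H}`. It is only used for nonempty weak* compact `H`,
for which the supremum is attained. -/
noncomputable def maxAffine (H : Set (ℝ × WeakDual ℝ X)) (u : X) : ℝ :=
  sSup ((fun p : ℝ × WeakDual ℝ X => p.1 + p.2 u) '' H)

/-- `H` is a hypodifferential of `f` at `x ∈ dom f`: `H` is weak* compact (the topology on
`ℝ × WeakDual ℝ X` is the product of the usual one and the weak* one), `max {a | (a, v) ∈ H} = 0`
(so `H` is nonempty), and for all `u`
`|f (x + α u) - f x - max {a + α ⟨v, u⟩ | (a, v) ∈ H}| / α → 0` as `α → +0`.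
The absolute value is taken in `[0, +∞]`, being `+∞` where `f (x + α u) = +∞`. -/
structure IsHypodifferential (f : X → EReal) (x : X) (H : Set (ℝ × WeakDual ℝ X)) : Prop where
  mem_dom : x ∈ effDom f
  compact : IsCompact H
  max_fst : IsGreatest (Prod.fst '' H) (0 : ℝ)
  approx : ∀ u : X, Tendsto
    (fun α : ℝ => (f (x + α • u) - f x - ((maxAffine H (α • u) : ℝ) : EReal)).abs
      / ENNReal.ofReal α)
    (𝓝[>] (0 : ℝ)) (𝓝 0)

/-- `f` is hypodifferentiable at `x`. -/
def HypodifferentiableAt (f : X → EReal) (x : X) : Prop :=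
  ∃ H : Set (ℝ × WeakDual ℝ X), IsHypodifferential f x H

/-- The three conditions on `H`: nonpositive first components, some `(0, v) ∈ H`, and
`{v | (0, v) ∈ H} = ∂f(x)`. -/
def HypodiffConditions (f : X → EReal) (x : X) (H : Set (ℝ × WeakDual ℝ X)) : Prop :=
  (∀ p ∈ H, p.1 ≤ 0) ∧
  (∃ v : WeakDual ℝ X, ((0 : ℝ), v) ∈ H) ∧
  {v : WeakDual ℝ X | ((0 : ℝ), v) ∈ H} = subdifferential f x

end ConvexHypo

namespace ConvexHypo

/-! Everything reduces to comparing support functions. An infinite value of `f` makes the error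
quotient infinite, so hypodifferentiability forces `x` into the algebraic interior of the domain
(`IsHypodifferential.mem_algCore`). There, a Baire argument (`exists_forall_ball_le`) makes the
directional derivative `p` a finite sublinear function dominated by a multiple of the norm. By
Hahn–Banach, `p` is the attained support function of the subdifferential, which is weak* compact by
Banach–Alaoglu.

At such a point the approximation property means `maxAffine H (α • u) / α → p u`. By compactness of
`H` this quotient tends to the support function of the slice `{v | (0, v) ∈ H}`
(`tendsto_maxAffine_div`). Equality of slice and subdifferential is thus sufficient; for convex `H`
it is also necessary, by weak* separation. Existence is witnessed by `{0} ×ˢ subdifferential f x`.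
-/

lemma coe_toReal_of_mem_effDom {X : Type*} {f : X → EReal} {x : X} (hx : x ∈ effDom f) : ((f x).toReal : EReal) = f x :=
  EReal.coe_toReal hx.1 hx.2

variable {X : Type*} [NormedAddCommGroup X] [NormedSpace ℝ X] {f : X → EReal} {x : X}

/-! ### Convexity on the effective domain -/

namespace IsClosedConvex

lemma mem_effDom_of_le (hf : IsClosedConvex f) {r : ℝ} (h : f x ≤ r) : x ∈ effDom f :=
  ⟨(h.trans_lt (EReal.coe_lt_top r)).ne, hf.ne_bot x⟩

lemma convex_sublevel (hf : IsClosedConvex f) (r : ℝ) : Convex ℝ {y | f y ≤ r} := by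
  intro y hy z hz a b ha hb hab
  have h := hf.convex (x := (y, r)) hy (y := (z, r)) hz ha hb hab
  have hr : a * r + b * r = r := by rw [← add_mul, hab, one_mul]
  simpa [epigraph, ← EReal.coe_mul, ← EReal.coe_add, hr] using h

/-- A closed convex function is convex, as a real function, on its effective domain. -/
lemma convexOn_toReal (hf : IsClosedConvex f) :
    ConvexOn ℝ (effDom f) (fun y => (f y).toReal) := by
  have key : ∀ y ∈ effDom f, ∀ z ∈ effDom f, ∀ a b : ℝ, 0 ≤ a → 0 ≤ b → a + b = 1 →
      f (a • y + b • z) ≤ ((a * (f y).toReal + b * (f z).toReal : ℝ) : EReal) := by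
    intro y hy z hz a b ha hb hab
    exact hf.convex (x := (y, (f y).toReal)) (coe_toReal_of_mem_effDom hy).ge
      (y := (z, (f z).toReal)) (coe_toReal_of_mem_effDom hz).ge ha hb hab
  refine ⟨fun y hy z hz a b ha hb hab => hf.mem_effDom_of_le (key y hy z hz a b ha hb hab), ?_⟩
  intro y hy z hz a b ha hb hab
  have h := key y hy z hz a b ha hb hab
  rw [← coe_toReal_of_mem_effDom (hf.mem_effDom_of_le h)] at h
  exact EReal.coe_le_coe_iff.1 h

end IsClosedConvex

/-! ### Algebraic interior and local boundedness -/

lemma interior_subset_algCore (Q : Set X) : interior Q ⊆ algCore Q := by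
  intro x hx
  refine ⟨interior_subset hx, fun y => ?_⟩
  have hc : Tendsto (fun t : ℝ => x + t • y) (𝓝 0) (𝓝 x) := by
    have : Continuous (fun t : ℝ => x + t • y) := by fun_prop
    simpa using this.tendsto 0
  obtain ⟨ε, hε, h⟩ := Metric.eventually_nhds_iff.1
    (hc.eventually (mem_interior_iff_mem_nhds.1 hx))
  refine ⟨ε / 2, by positivity, fun t ht => h ?_⟩
  rw [Real.dist_eq, sub_zero, abs_of_nonneg ht.1]
  linarith [ht.2]

/-- Using both `u` and `-u` gives a two-sided interval, which places `0` in the interior of the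
domain of the restriction to a line, as one-variable convex calculus requires. -/
lemma eventually_mem_of_mem_algCore {Q : Set X} (hx : x ∈ algCore Q) (u : X) :
    ∀ᶠ t : ℝ in 𝓝 0, x + t • u ∈ Q := by
  obtain ⟨τ, hτ, h⟩ := hx.2 u
  obtain ⟨σ, hσ, h'⟩ := hx.2 (-u)
  filter_upwards [Ioo_mem_nhds (neg_neg_of_pos hσ) hτ] with t ht
  rcases le_total 0 t with h0 | h0
  · exact h t ⟨h0, ht.2.le⟩
  · simpa using h' (-t) ⟨by linarith, by linarith [ht.1]⟩

/-- On a Banach space, a closed convex function is bounded above near every point of the algebraic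
interior of its effective domain. -/
lemma IsClosedConvex.exists_forall_ball_le [CompleteSpace X] (hf : IsClosedConvex f)
    (hx : x ∈ algCore (effDom f)) :
    ∃ r : ℝ, 0 < r ∧ ∃ M : ℝ, ∀ u : X, ‖u‖ < r → f (x + u) ≤ M := by
  -- Baire category is applied to the symmetrized sets `F m`: they are closed, convex and cover `X`,
  -- and symmetry moves an interior point to `0` as the midpoint of `z` and `-z`.
  let A : ℕ → Set X := fun m => {y | f (x + (1 / ((m : ℝ) + 1)) • y) ≤ ((m + 1 : ℝ) : EReal)}
  let F : ℕ → Set X := fun m => A m ∩ -A m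
  have hAc : ∀ m, IsClosed (A m) := fun m =>
    (hf.lsc.isClosed_preimage ((m + 1 : ℝ) : EReal)).preimage
      (f := fun y => x + (1 / ((m : ℝ) + 1)) • y) (by fun_prop)
  have hAconv : ∀ m, Convex ℝ (A m) := fun m => by
    have h := ((hf.convex_sublevel (m + 1)).translate_preimage_right x).smul_preimage
      (1 / ((m : ℝ) + 1))
    exact h
  have hFc : ∀ m, IsClosed (F m) := fun m => (hAc m).inter ((hAc m).preimage continuous_neg)
  have hFconv : ∀ m, Convex ℝ (F m) := fun m => (hAconv m).inter (hAconv m).neg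
  have hFu : ⋃ m, F m = Set.univ := by
    have hA : ∀ y, ∀ᶠ m : ℕ in atTop, y ∈ A m := by
      intro y
      obtain ⟨τ, hτ, h⟩ := hx.2 y
      have hd := h τ ⟨hτ.le, le_rfl⟩
      have hlim : Tendsto (fun m : ℕ => (m : ℝ) + 1) atTop atTop :=
        tendsto_atTop_add_const_right _ _ tendsto_natCast_atTop_atTop
      -- The first threshold puts the scaled point on the segment from `x` to `x + τ • y`; the other
      -- two bound `f` at its endpoints.
      filter_upwards [hlim.eventually_ge_atTop (1 / τ),
        hlim.eventually_ge_atTop (f x).toReal,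
        hlim.eventually_ge_atTop (f (x + τ • y)).toReal] with m h1 h2 h3
      have hm : (0 : ℝ) < m + 1 := by positivity
      have e1 : x ∈ {y | f y ≤ ((m + 1 : ℝ) : EReal)} := by
        rw [Set.mem_ofPred_eq, ← coe_toReal_of_mem_effDom hx.1]
        exact EReal.coe_le_coe_iff.2 h2
      have e2 : x + τ • y ∈ {y | f y ≤ ((m + 1 : ℝ) : EReal)} := by
        rw [Set.mem_ofPred_eq, ← coe_toReal_of_mem_effDom hd]
        exact EReal.coe_le_coe_iff.2 h3
      have h4 := (hf.convex_sublevel (m + 1)).add_smul_mem e1 e2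
        (t := 1 / ((m : ℝ) + 1) / τ) ⟨by positivity, by
          rw [div_le_one hτ, div_le_iff₀ hm]
          rw [div_le_iff₀ hτ] at h1
          linarith⟩
      rwa [smul_smul, div_mul_cancel₀ _ hτ.ne'] at h4
    refine Set.eq_univ_of_forall fun y => ?_
    obtain ⟨m, h1, h2⟩ := ((hA y).and (hA (-y))).exists
    exact Set.mem_iUnion.2 ⟨m, h1, h2⟩
  obtain ⟨m, z, hz⟩ := nonempty_interior_of_iUnion_of_closed hFc hFu
  have hz' : -z ∈ interior (F m) := by
    have hneg : -F m = F m := by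
      simp only [F, Set.inter_neg, neg_neg, Set.inter_comm]
    have hsub : -interior (F m) ⊆ F m := by
      conv_rhs => rw [← hneg]
      exact Set.neg_subset_neg.2 interior_subset
    exact interior_maximal hsub (isOpen_interior.preimage continuous_neg)
      (by simpa using hz : -z ∈ -interior (F m))
  have h0 : (0 : X) ∈ interior (F m) := by
    have := (hFconv m).interior hz hz' (a := 1 / 2) (b := 1 / 2) (by norm_num) (by norm_num)
      (by norm_num)
    simpa using this
  obtain ⟨r, hr, hb⟩ := Metric.mem_nhds_iff.1 (mem_interior_iff_mem_nhds.1 h0)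
  have hm : (0 : ℝ) < m + 1 := by positivity
  refine ⟨r / (m + 1), by positivity, m + 1, fun u hu => ?_⟩
  have hmem : ((m : ℝ) + 1) • u ∈ A m := by
    refine (hb ?_).1
    rw [mem_ball_zero_iff, norm_smul, Real.norm_of_nonneg hm.le]
    rwa [lt_div_iff₀' hm] at hu
  have : f (x + (1 / ((m : ℝ) + 1)) • ((m : ℝ) + 1) • u) ≤ ((m + 1 : ℝ) : EReal) := hmem
  rwa [smul_smul, one_div_mul_cancel hm.ne', one_smul] at this

/-- The directional derivative of the real function `y ↦ (f y).toReal`. -/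
noncomputable def dirDeriv (f : X → EReal) (x u : X) : ℝ :=
  derivWithin (fun t : ℝ => (f (x + t • u)).toReal) (Set.Ioi 0) 0

/-! ### Directional derivative and subdifferential at core points -/

section Core

variable (hf : IsClosedConvex f) (hx : x ∈ algCore (effDom f))
include hf

lemma IsClosedConvex.convexOn_line (u : X) :
    ConvexOn ℝ {t : ℝ | x + t • u ∈ effDom f} (fun t : ℝ => (f (x + t • u)).toReal) := by
  have h := hf.convexOn_toReal.comp_affineMap (AffineMap.lineMap x (x + u))
  have e : ∀ t : ℝ, AffineMap.lineMap x (x + u) t = x + t • u := fun t => by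
    simp [AffineMap.lineMap_apply, add_comm]
  simpa only [Function.comp_def, e, Set.preimage] using h

include hx

lemma IsClosedConvex.tendsto_dirDeriv (u : X) :
    Tendsto (fun t : ℝ => ((f (x + t • u)).toReal - (f x).toReal) / t) (𝓝[>] 0)
      (𝓝 (dirDeriv f x u)) := by
  have h := (hf.convexOn_line (x := x) u).hasDerivWithinAt_rightDeriv_of_mem_interior (x := 0)
    (mem_interior_iff_mem_nhds.2 (eventually_mem_of_mem_algCore hx u))
  rw [hasDerivWithinAt_iff_tendsto_slope' Set.self_notMem_Ioi] at h
  simpa [slope_fun_def_field, dirDeriv] using h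

lemma IsClosedConvex.dirDeriv_le_sub {u : X} (hu : x + u ∈ effDom f) :
    dirDeriv f x u ≤ (f (x + u)).toReal - (f x).toReal := by
  have h := (hf.convexOn_line (x := x) u).rightDeriv_le_slope_of_mem_interior (x := 0) (y := 1)
    (mem_interior_iff_mem_nhds.2 (eventually_mem_of_mem_algCore hx u)) (by simpa using hu)
    one_pos
  simpa [slope_def_field, dirDeriv] using h

lemma IsClosedConvex.dirDeriv_smul {c : ℝ} (hc : 0 < c) (u : X) :
    dirDeriv f x (c • u) = c * dirDeriv f x u := by
  have hlim : Tendsto (fun t : ℝ => t * c) (𝓝[>] 0) (𝓝[>] 0) := by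
    refine tendsto_nhdsWithin_iff.2 ⟨?_, ?_⟩
    · have : Tendsto (fun t : ℝ => t * c) (𝓝 0) (𝓝 (0 * c)) := tendsto_id.mul_const c
      rw [zero_mul] at this
      exact this.mono_left nhdsWithin_le_nhds
    · filter_upwards [self_mem_nhdsWithin] with t ht using mul_pos ht hc
  refine tendsto_nhds_unique (hf.tendsto_dirDeriv hx (c • u)) ?_
  refine (((hf.tendsto_dirDeriv hx u).comp hlim).const_mul c).congr fun t => ?_
  simp only [Function.comp_apply, smul_smul]
  field_simp

/-- Convexity at the midpoint of `x + t • u` and `x + t • w` passes to the limit; homogeneity then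
removes the factor 1/2. -/
lemma IsClosedConvex.dirDeriv_add_le (u w : X) :
    dirDeriv f x (u + w) ≤ dirDeriv f x u + dirDeriv f x w := by
  have hmid : dirDeriv f x ((1 / 2 : ℝ) • (u + w)) ≤
      1 / 2 * dirDeriv f x u + 1 / 2 * dirDeriv f x w := by
    refine le_of_tendsto_of_tendsto (hf.tendsto_dirDeriv hx _)
      (((hf.tendsto_dirDeriv hx u).const_mul (1 / 2)).add
        ((hf.tendsto_dirDeriv hx w).const_mul (1 / 2))) ?_
    filter_upwards [nhdsWithin_le_nhds (eventually_mem_of_mem_algCore hx u),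
      nhdsWithin_le_nhds (eventually_mem_of_mem_algCore hx w), self_mem_nhdsWithin]
      with t hu hw (ht : 0 < t)
    have h := hf.convexOn_toReal.2 hu hw (by norm_num : (0 : ℝ) ≤ 1 / 2)
      (by norm_num : (0 : ℝ) ≤ 1 / 2) (by norm_num)
    have e : (1 / 2 : ℝ) • (x + t • u) + (1 / 2 : ℝ) • (x + t • w) =
        x + t • (1 / 2 : ℝ) • (u + w) := by
      module
    simp only [e, smul_eq_mul] at h
    rw [← mul_div_assoc, ← mul_div_assoc, ← add_div]
    gcongr
    linarith
  rw [hf.dirDeriv_smul hx (by norm_num)] at hmid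
  linarith

/-- On a Banach space, the directional derivative at a point of the algebraic interior of the
effective domain is dominated by a multiple of the norm. -/
lemma IsClosedConvex.exists_dirDeriv_le_norm [CompleteSpace X] :
    ∃ L : ℝ, 0 ≤ L ∧ ∀ u, dirDeriv f x u ≤ L * ‖u‖ := by
  obtain ⟨r, hr, M, hM⟩ := hf.exists_forall_ball_le hx
  have hzero : dirDeriv f x 0 = 0 := by simp [dirDeriv]
  have hsmall : ∀ u : X, ‖u‖ < r → dirDeriv f x u ≤ M - (f x).toReal := fun u hu => by
    have hd := hf.mem_effDom_of_le (hM u hu)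
    have h := hM u hu
    rw [← coe_toReal_of_mem_effDom hd, EReal.coe_le_coe_iff] at h
    linarith [hf.dirDeriv_le_sub hx hd]
  have hC : 0 ≤ M - (f x).toReal := by
    have := hsmall 0 (by simpa using hr)
    rwa [hzero] at this
  refine ⟨(M - (f x).toReal) / (r / 2), by positivity, fun u => ?_⟩
  rcases eq_or_ne u 0 with rfl | hu
  · simp [hzero]
  have hu' : 0 < ‖u‖ := norm_pos_iff.2 hu
  -- Rescaling to norm `r / 2` stays strictly inside the ball where the bound holds.
  have h := hsmall ((r / 2 / ‖u‖) • u) (by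
    rw [norm_smul, Real.norm_of_nonneg (by positivity), div_mul_cancel₀ _ hu'.ne']
    linarith)
  rw [hf.dirDeriv_smul hx (by positivity)] at h
  rw [div_mul_eq_mul_div, le_div_iff₀ (by positivity)]
  rw [div_mul_eq_mul_div, div_le_iff₀ hu'] at h
  linarith

/-- One direction divides the subgradient inequality at `x + t • u` by `t` and lets `t → +0`; the
other uses that a convex difference quotient at step 1 dominates its limit. -/
lemma IsClosedConvex.mem_subdifferential_iff (v : WeakDual ℝ X) :
    v ∈ subdifferential f x ↔ ∀ u, v u ≤ dirDeriv f x u := by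
  constructor
  · rintro ⟨-, hv⟩ u
    refine ge_of_tendsto (hf.tendsto_dirDeriv hx u) ?_
    filter_upwards [nhdsWithin_le_nhds (eventually_mem_of_mem_algCore hx u), self_mem_nhdsWithin]
      with t hu (ht : 0 < t)
    have h := hv (x + t • u)
    rw [← coe_toReal_of_mem_effDom hu, ← coe_toReal_of_mem_effDom hx.1, ← EReal.coe_add,
      EReal.coe_le_coe_iff, add_sub_cancel_left, map_smul, smul_eq_mul] at h
    rw [le_div_iff₀ ht]
    linarith
  · intro hv
    refine ⟨hx.1, fun y => ?_⟩
    by_cases hy : f y = ⊤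
    · rw [hy]; exact le_top
    have hyd : x + (y - x) ∈ effDom f := by
      rw [add_sub_cancel]; exact ⟨hy, hf.ne_bot y⟩
    have h := hf.dirDeriv_le_sub hx hyd
    rw [add_sub_cancel] at h hyd
    rw [← coe_toReal_of_mem_effDom hyd, ← coe_toReal_of_mem_effDom hx.1, ← EReal.coe_add,
      EReal.coe_le_coe_iff]
    linarith [hv (y - x)]

lemma IsClosedConvex.exists_mem_subdifferential_eq [CompleteSpace X] (u : X) :
    ∃ v ∈ subdifferential f x, v u = dirDeriv f x u := by
  obtain ⟨L, hL, hLb⟩ := hf.exists_dirDeriv_le_norm hx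
  have hzero : dirDeriv f x 0 = 0 := by simp [dirDeriv]
  have key : ∃ g : X →ₗ[ℝ] ℝ, g u = dirDeriv f x u ∧ ∀ w, g w ≤ dirDeriv f x w := by
    rcases eq_or_ne u 0 with rfl | hu
    · obtain ⟨g, -, hg⟩ := exists_extension_of_le_sublinear (⊥ : X →ₗ.[ℝ] ℝ) (dirDeriv f x)
        (fun c hc w => hf.dirDeriv_smul hx hc w) (hf.dirDeriv_add_le hx) (by
          rintro ⟨w, hw⟩
          obtain rfl : w = 0 := (Submodule.mem_bot ℝ).1 hw
          have : (⊥ : X →ₗ.[ℝ] ℝ) ⟨0, hw⟩ = 0 := LinearPMap.map_zero _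
          rw [this, hzero])
      exact ⟨g, by rw [map_zero, hzero], hg⟩
    · obtain ⟨g, hg1, hg2⟩ := exists_extension_of_le_sublinear
        (LinearPMap.mkSpanSingleton (K := ℝ) u (dirDeriv f x u) hu) (dirDeriv f x)
        (fun c hc w => hf.dirDeriv_smul hx hc w) (hf.dirDeriv_add_le hx) (by
          rintro ⟨w, hw⟩
          obtain ⟨c, rfl⟩ := Submodule.mem_span_singleton.1 hw
          refine (LinearPMap.mkSpanSingleton'_apply u (dirDeriv f x u) _ c hw).trans_le ?_
          change c * dirDeriv f x u ≤ dirDeriv f x (c • u)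
          rcases lt_trichotomy c 0 with hc | rfl | hc
          -- For negative `c`, subadditivity at `c • u` and `-c • u`, whose sum is `0`, gives the
          -- bound.
          · have h1 := hf.dirDeriv_smul hx (neg_pos.2 hc) u
            have h2 := hf.dirDeriv_add_le hx (c • u) (-c • u)
            rw [← add_smul, add_neg_cancel, zero_smul, hzero, h1] at h2
            linarith
          · simp [hzero]
          · rw [hf.dirDeriv_smul hx hc])
      refine ⟨g, ?_, hg2⟩
      exact (hg1 ⟨u, Submodule.mem_span_singleton_self u⟩).trans
        (LinearPMap.mkSpanSingleton_apply ℝ ℝ hu (dirDeriv f x u))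
  obtain ⟨g, hgu, hg⟩ := key
  let v : StrongDual ℝ X := g.mkContinuous L fun w => by
    rw [Real.norm_eq_abs, abs_le]
    refine ⟨?_, (hg w).trans (hLb w)⟩
    have := (hg (-w)).trans (hLb (-w))
    rw [map_neg, norm_neg] at this
    linarith
  exact ⟨StrongDual.toWeakDual v, (hf.mem_subdifferential_iff hx _).2 hg, hgu⟩

lemma IsClosedConvex.isCompact_subdifferential [CompleteSpace X] :
    IsCompact (subdifferential f x) := by
  obtain ⟨L, hL, hLb⟩ := hf.exists_dirDeriv_le_norm hx
  have hclosed : IsClosed (subdifferential f x) := by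
    have : subdifferential f x = ⋂ u : X, {v : WeakDual ℝ X | v u ≤ dirDeriv f x u} := by
      ext v
      simp [hf.mem_subdifferential_iff hx]
    rw [this]
    exact isClosed_iInter fun u => isClosed_le (WeakDual.eval_continuous u) continuous_const
  refine (WeakDual.isCompact_closedBall (𝕜 := ℝ) (E := X) 0 L).of_isClosed_subset hclosed ?_
  intro v hv
  rw [hf.mem_subdifferential_iff hx] at hv
  change WeakDual.toStrongDual v ∈ Metric.closedBall 0 L
  rw [mem_closedBall_zero_iff]
  refine ContinuousLinearMap.opNorm_le_bound _ hL fun w => ?_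
  rw [Real.norm_eq_abs, abs_le]
  refine ⟨?_, (hv w).trans (hLb w)⟩
  have := (hv (-w)).trans (hLb (-w))
  rw [map_neg, norm_neg] at this
  change -(L * ‖w‖) ≤ v w
  linarith

lemma IsClosedConvex.hasDirDeriv_dirDeriv (u : X) : HasDirDeriv f x u (dirDeriv f x u) := by
  refine ((continuous_coe_real_ereal.tendsto _).comp (hf.tendsto_dirDeriv hx u)).congr' ?_
  filter_upwards [nhdsWithin_le_nhds (eventually_mem_of_mem_algCore hx u)] with t hu
  rw [Function.comp_apply, EReal.coe_div, EReal.coe_sub, coe_toReal_of_mem_effDom hu,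
    coe_toReal_of_mem_effDom hx.1]

lemma IsClosedConvex.isProperClosedConvex_dirDeriv [CompleteSpace X] :
    IsProperClosedConvex (fun u => (dirDeriv f x u : EReal)) := by
  obtain ⟨L, hL, hLb⟩ := hf.exists_dirDeriv_le_norm hx
  have hzero : dirDeriv f x 0 = 0 := by simp [dirDeriv]
  have hsmul : ∀ {c : ℝ}, 0 ≤ c → ∀ u, dirDeriv f x (c • u) = c * dirDeriv f x u := by
    intro c hc u
    rcases hc.eq_or_lt with rfl | hc
    · simp [hzero]
    · exact hf.dirDeriv_smul hx hc u
  refine ⟨⟨fun u => EReal.coe_ne_bot _, ?_, ?_⟩, 0, EReal.coe_ne_top _⟩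
  · rintro ⟨u, r⟩ hu ⟨w, s⟩ hw a b ha hb hab
    have hu : dirDeriv f x u ≤ r := EReal.coe_le_coe_iff.1 hu
    have hw : dirDeriv f x w ≤ s := EReal.coe_le_coe_iff.1 hw
    refine EReal.coe_le_coe_iff.2 ((hf.dirDeriv_add_le hx _ _).trans ?_)
    change dirDeriv f x (a • u) + dirDeriv f x (b • w) ≤ a * r + b * s
    rw [hsmul ha, hsmul hb]
    gcongr
  -- Subadditivity and the norm bound give `p u ≤ p w + L * ‖u - w‖`, hence continuity.
  · have hlip : LipschitzWith ⟨L, hL⟩ (dirDeriv f x) := LipschitzWith.of_le_add_mul _ fun u w => by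
      have h := hf.dirDeriv_add_le hx w (u - w)
      rw [add_sub_cancel] at h
      rw [dist_eq_norm]
      exact h.trans (add_le_add_right (hLb (u - w)) _)
    exact (continuous_coe_real_ereal.comp hlip.continuous).lowerSemicontinuous

end Core

/-! ### Maxima of affine functions over weak* compact sets -/

section MaxAffine

variable {H : Set (ℝ × WeakDual ℝ X)}

lemma continuous_affine_eval (u : X) :
    Continuous (fun p : ℝ × WeakDual ℝ X => p.1 + p.2 u) :=
  continuous_fst.add ((WeakDual.eval_continuous u).comp continuous_snd)

lemma isGreatest_maxAffine (hH : IsCompact H) (hne : H.Nonempty) (u : X) :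
    IsGreatest ((fun p : ℝ × WeakDual ℝ X => p.1 + p.2 u) '' H) (maxAffine H u) :=
  (hH.image (continuous_affine_eval u)).isGreatest_sSup (hne.image _)

lemma isCompact_zeroSlice (hH : IsCompact H) : IsCompact {v | ((0 : ℝ), v) ∈ H} :=
  (hH.image continuous_snd).of_isClosed_subset
    (hH.isClosed.preimage (by fun_prop : Continuous fun v : WeakDual ℝ X => ((0 : ℝ), v)))
    fun v hv => ⟨(0, v), hv, rfl⟩

/-- The quotient `maxAffine H (α u) / α` tends to the maximum of `⟨v, u⟩` over the slice
`{v | (0, v) ∈ H}` as `α → +0`. -/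
lemma tendsto_maxAffine_div (hH : IsCompact H) (hmax : ∀ p ∈ H, p.1 ≤ 0) {u : X} {d : ℝ}
    (hd : IsGreatest ((fun v : WeakDual ℝ X => v u) '' {v | ((0 : ℝ), v) ∈ H}) d) :
    Tendsto (fun α : ℝ => maxAffine H (α • u) / α) (𝓝[>] 0) (𝓝 d) := by
  obtain ⟨v, hv, hvd⟩ := hd.1
  have hvd : v u = d := hvd
  have hne : H.Nonempty := ⟨_, hv⟩
  have hev : Continuous (fun p : ℝ × WeakDual ℝ X => p.2 u) :=
    (WeakDual.eval_continuous u).comp continuous_snd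
  refine tendsto_order.2 ⟨fun b hb => ?_, fun b hb => ?_⟩
  · filter_upwards [self_mem_nhdsWithin] with α (hα : 0 < α)
    refine hb.trans_le ((le_div_iff₀ hα).2 ?_)
    refine le_trans (le_of_eq ?_) ((isGreatest_maxAffine hH hne (α • u)).2 ⟨_, hv, rfl⟩)
    simp only [map_smul, smul_eq_mul, hvd, zero_add, mul_comm]
  obtain ⟨c, hdc, hcb⟩ := exists_between hb
  -- Pairs in `K` have slope above the slice maximum `d`, so their first component cannot vanish; by
  -- compactness it is at most `-δ`. For small `α` this penalty outweighs the possible gain `α * (C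
  -- - c)`.
  let K : Set (ℝ × WeakDual ℝ X) := H ∩ {p | c ≤ p.2 u}
  have hK : IsCompact K := hH.inter_right (isClosed_le continuous_const hev)
  obtain ⟨δ, hδ, hKδ⟩ : ∃ δ : ℝ, 0 < δ ∧ ∀ p ∈ K, p.1 ≤ -δ := by
    rcases K.eq_empty_or_nonempty with hKe | hKne
    · exact ⟨1, one_pos, by simp [hKe]⟩
    obtain ⟨q, hq, hqmax⟩ := hK.exists_isMaxOn hKne continuous_fst.continuousOn
    refine ⟨-q.1, neg_pos.2 ((hmax q hq.1).lt_of_ne fun h0 => ?_), fun p hp => ?_⟩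
    · have hq0 : ((0 : ℝ), q.2) ∈ H := by rw [← h0]; exact hq.1
      have h1 : q.2 u ≤ d := hd.2 ⟨q.2, hq0, rfl⟩
      have h2 : c ≤ q.2 u := hq.2
      linarith
    · rw [neg_neg]; exact hqmax hp
  obtain ⟨C, hC⟩ := (hH.image hev).bddAbove
  have hlim : Tendsto (fun α : ℝ => α * (C - c)) (𝓝[>] 0) (𝓝 0) := by
    have h : Tendsto (fun α : ℝ => α * (C - c)) (𝓝 0) (𝓝 (0 * (C - c))) :=
      tendsto_id.mul_const _
    rw [zero_mul] at h
    exact h.mono_left nhdsWithin_le_nhds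
  filter_upwards [self_mem_nhdsWithin, hlim.eventually_le_const hδ] with α (hα : 0 < α) hαδ
  refine lt_of_le_of_lt ((div_le_iff₀ hα).2 ?_) hcb
  obtain ⟨p, hp, hpe⟩ := (isGreatest_maxAffine hH hne (α • u)).1
  rw [← hpe]
  simp only [map_smul, smul_eq_mul]
  by_cases hpc : c ≤ p.2 u
  · have h1 := hKδ p ⟨hp, hpc⟩
    have h2 : p.2 u ≤ C := hC ⟨p, hp, rfl⟩
    have h3 := mul_le_mul_of_nonneg_left h2 hα.le
    linarith
  · have h1 := hmax p hp
    have h3 := mul_le_mul_of_nonneg_left (not_le.1 hpc).le hα.le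
    linarith

end MaxAffine

/-- A functional dominated by the support function of a weak* closed convex set belongs to it. -/
lemma mem_of_forall_exists_eval_le {S : Set (WeakDual ℝ X)} (hconv : Convex ℝ S)
    (hcl : IsClosed S) {v : WeakDual ℝ X} (h : ∀ u : X, ∃ w ∈ S, v u ≤ w u) : v ∈ S := by
  by_contra hv
  have : LocallyConvexSpace ℝ (WeakDual ℝ X) :=
    (WeakDual.withSeminorms ℝ X).toLocallyConvexSpace
  obtain ⟨g, c, hgS, hgv⟩ := geometric_hahn_banach_closed_point hconv hcl hv
  -- Weak* continuous functionals are evaluations at points of `X`, so the separating functional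
  -- contradicts `h` at one `u`.
  obtain ⟨u, hu⟩ := LinearMap.dualEmbedding_surjective (topDualPairing ℝ X) g
  have hg : ∀ w : WeakDual ℝ X, g w = w u := fun w => by rw [← hu]; rfl
  obtain ⟨w, hw, hle⟩ := h u
  have h1 := hgS w hw
  rw [hg] at h1 hgv
  linarith

/-- Once the error quotient is below 1 it cannot be infinite, so `f` is finite on an initial piece
of every ray from `x`. -/
lemma IsHypodifferential.mem_algCore (hf : IsClosedConvex f) {H : Set (ℝ × WeakDual ℝ X)}
    (hH : IsHypodifferential f x H) : x ∈ algCore (effDom f) := by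
  refine ⟨hH.mem_dom, fun u => ?_⟩
  have h : ∀ᶠ α : ℝ in 𝓝[>] 0, x + α • u ∈ effDom f := by
    filter_upwards [(hH.approx u).eventually_lt_const one_pos, self_mem_nhdsWithin]
      with α hα (hα0 : 0 < α)
    refine ⟨fun htop => ?_, hf.ne_bot _⟩
    rw [htop, ← coe_toReal_of_mem_effDom hH.mem_dom, EReal.top_sub_coe, EReal.top_sub_coe,
      EReal.abs_top, ENNReal.top_div_of_ne_top ENNReal.ofReal_ne_top] at hα
    exact not_top_lt hα
  obtain ⟨τ, hτ, hs⟩ := (mem_nhdsGT_iff_exists_Ioc_subset).1 h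
  refine ⟨τ, hτ, fun t ht => ?_⟩
  rcases ht.1.eq_or_lt with rfl | h0
  · simpa using hH.mem_dom
  · exact hs ⟨h0, ht.2⟩

/-! ### Hypodifferentials at core points -/

section Core

variable (hf : IsClosedConvex f) (hx : x ∈ algCore (effDom f))
include hf hx

/-- At a point of the algebraic interior of the effective domain, the approximation property of a
hypodifferential says that `maxAffine H` has the same directional derivatives as `f`. -/
lemma IsClosedConvex.approx_iff_tendsto_maxAffine_div (H : Set (ℝ × WeakDual ℝ X)) (u : X) :
    Tendsto (fun α : ℝ => (f (x + α • u) - f x - ((maxAffine H (α • u) : ℝ) : EReal)).abs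
      / ENNReal.ofReal α) (𝓝[>] 0) (𝓝 0) ↔
    Tendsto (fun α : ℝ => maxAffine H (α • u) / α) (𝓝[>] 0) (𝓝 (dirDeriv f x u)) := by
  let q : ℝ → ℝ := fun α => ((f (x + α • u)).toReal - (f x).toReal) / α
  let m : ℝ → ℝ := fun α => maxAffine H (α • u) / α
  have hq : Tendsto q (𝓝[>] 0) (𝓝 (dirDeriv f x u)) := hf.tendsto_dirDeriv hx u
  have heq : (fun α : ℝ => (f (x + α • u) - f x - ((maxAffine H (α • u) : ℝ) : EReal)).abs
      / ENNReal.ofReal α) =ᶠ[𝓝[>] 0] fun α => ENNReal.ofReal |q α - m α| := by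
    filter_upwards [nhdsWithin_le_nhds (eventually_mem_of_mem_algCore hx u), self_mem_nhdsWithin]
      with α hu (hα : 0 < α)
    rw [← coe_toReal_of_mem_effDom hu, ← coe_toReal_of_mem_effDom hx.1, ← EReal.coe_sub,
      ← EReal.coe_sub, EReal.abs_def, ← ENNReal.ofReal_div_of_pos hα, ← sub_div, abs_div,
      abs_of_pos hα]
  rw [tendsto_congr' heq]
  constructor
  · intro h
    have h1 : Tendsto (fun α => |q α - m α|) (𝓝[>] 0) (𝓝 0) := by
      have := (ENNReal.tendsto_toReal ENNReal.zero_ne_top).comp h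
      simpa [Function.comp_def, ENNReal.toReal_ofReal] using this
    have h2 := hq.sub (tendsto_zero_iff_abs_tendsto_zero _ |>.2 h1)
    simpa using h2
  · intro h
    have h1 : Tendsto (fun α => |q α - m α|) (𝓝[>] 0) (𝓝 0) := by
      simpa using (hq.sub h).abs
    simpa using ENNReal.tendsto_ofReal h1

lemma IsClosedConvex.isGreatest_dirDeriv [CompleteSpace X] (u : X) :
    IsGreatest ((fun v : WeakDual ℝ X => v u) '' subdifferential f x) (dirDeriv f x u) := by
  refine ⟨hf.exists_mem_subdifferential_eq hx u, ?_⟩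
  rintro _ ⟨v, hv, rfl⟩
  exact (hf.mem_subdifferential_iff hx v).1 hv u

lemma IsClosedConvex.isHypodifferential_of_conditions [CompleteSpace X]
    {H : Set (ℝ × WeakDual ℝ X)} (hH : IsCompact H) (h : HypodiffConditions f x H) :
    IsHypodifferential f x H := by
  obtain ⟨hmax, ⟨v, hv⟩, hslice⟩ := h
  refine ⟨hx.1, hH, ⟨⟨_, hv, rfl⟩, ?_⟩, fun u => ?_⟩
  · rintro _ ⟨p, hp, rfl⟩
    exact hmax p hp
  · refine (hf.approx_iff_tendsto_maxAffine_div hx H u).2 (tendsto_maxAffine_div hH hmax ?_)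
    rw [hslice]
    exact hf.isGreatest_dirDeriv hx u

omit hx in
-- Uniqueness of limits identifies `dirDeriv f x` with the support function of the zero slice.
-- Convexity of `H` serves only the inclusion of the subdifferential in that slice.
lemma IsHypodifferential.conditions {H : Set (ℝ × WeakDual ℝ X)}
    (hH : IsHypodifferential f x H) (hconv : Convex ℝ H) : HypodiffConditions f x H := by
  have hx := hH.mem_algCore hf
  have hmax : ∀ p ∈ H, p.1 ≤ 0 := fun p hp => hH.max_fst.2 ⟨p, hp, rfl⟩
  obtain ⟨⟨a, v₀⟩, hv₀, ha⟩ := hH.max_fst.1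
  obtain rfl : a = 0 := ha
  have hSc := isCompact_zeroSlice hH.compact
  have hSconv : Convex ℝ {v : WeakDual ℝ X | ((0 : ℝ), v) ∈ H} := by
    intro v hv w hw a b h1 h2 h3
    have := hconv hv hw h1 h2 h3
    simpa using this
  have hgr : ∀ u : X, IsGreatest ((fun v : WeakDual ℝ X => v u) '' {v | ((0 : ℝ), v) ∈ H})
      (dirDeriv f x u) := by
    intro u
    obtain ⟨d, hd⟩ := (hSc.image (WeakDual.eval_continuous u)).exists_isGreatest
      ⟨_, v₀, hv₀, rfl⟩
    have h1 := (hf.approx_iff_tendsto_maxAffine_div hx H u).1 (hH.approx u)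
    rwa [tendsto_nhds_unique h1 (tendsto_maxAffine_div hH.compact hmax hd)]
  refine ⟨hmax, ⟨v₀, hv₀⟩, Set.Subset.antisymm (fun v hv => ?_) fun v hv => ?_⟩
  · exact (hf.mem_subdifferential_iff hx v).2 fun u => (hgr u).2 ⟨v, hv, rfl⟩
  · refine mem_of_forall_exists_eval_le hSconv hSc.isClosed fun u => ?_
    obtain ⟨w, hw, hwe⟩ := (hgr u).1
    exact ⟨w, hw, ((hf.mem_subdifferential_iff hx v).1 hv u).trans hwe.ge⟩

lemma IsClosedConvex.hypodifferentiableAt [CompleteSpace X] : HypodifferentiableAt f x := by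
  refine ⟨{0} ×ˢ subdifferential f x, hf.isHypodifferential_of_conditions hx
    (isCompact_singleton.prod (hf.isCompact_subdifferential hx)) ⟨?_, ?_, ?_⟩⟩
  · rintro ⟨a, v⟩ ⟨ha, -⟩
    exact le_of_eq ha
  · obtain ⟨v, hv, -⟩ := hf.exists_mem_subdifferential_eq hx 0
    exact ⟨v, rfl, hv⟩
  · ext v
    simp

end Core

end ConvexHypo

theorem mainTheorem1 {X : Type*} [NormedAddCommGroup X] [NormedSpace ℝ X] [CompleteSpace X]
    (f : X → EReal) (hf : ConvexHypo.IsClosedConvex f) :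
    (∀ x ∈ interior (ConvexHypo.effDom f), ConvexHypo.HypodifferentiableAt f x) ∧
    (∀ x : X, ConvexHypo.HypodifferentiableAt f x →
      x ∈ ConvexHypo.algCore (ConvexHypo.effDom f) ∧
      (ConvexHypo.subdifferential f x).Nonempty ∧
      IsCompact (ConvexHypo.subdifferential f x) ∧
      ∃ D : X → EReal, (∀ u : X, ConvexHypo.HasDirDeriv f x u (D u)) ∧
        ConvexHypo.IsProperClosedConvex D) ∧
    (∀ x : X, ConvexHypo.HypodifferentiableAt f x →
      ∀ H : Set (ℝ × WeakDual ℝ X), IsCompact H →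
        (Convex ℝ H →
          (ConvexHypo.IsHypodifferential f x H ↔ ConvexHypo.HypodiffConditions f x H)) ∧
        (ConvexHypo.HypodiffConditions f x H → ConvexHypo.IsHypodifferential f x H)) := by
  refine ⟨fun x hx => hf.hypodifferentiableAt (ConvexHypo.interior_subset_algCore _ hx), ?_, ?_⟩
  · rintro x ⟨H₀, hH₀⟩
    have hx := hH₀.mem_algCore hf
    obtain ⟨v, hv, -⟩ := hf.exists_mem_subdifferential_eq hx 0
    exact ⟨hx, ⟨v, hv⟩, hf.isCompact_subdifferential hx, _, hf.hasDirDeriv_dirDeriv hx,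
      hf.isProperClosedConvex_dirDeriv hx⟩
  · rintro x ⟨H₀, hH₀⟩ H hH
    have hsuff := hf.isHypodifferential_of_conditions (hH₀.mem_algCore hf) hH
    exact ⟨fun hconv => ⟨fun h => h.conditions hf hconv, hsuff⟩, hsuff⟩
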